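/- An \emph{addition chain} for a positive integer $n$, of length $s$, is a sequence $(a_0,\dots,a_s)$ with $a_0=1$, $a_s=n$ such that for every $1\le k\le s$ there are $0\le i,j<k$ with $a_k=a_i+a_j$. For a set $A$ of addition chains let $\ell^A(n)$ be the least length of a chain in $A$ for $n$, and let $\nu_2(n)$ be the number of $1$'s in the binary expansion of $n$. The set $A$ is \emph{admissible} if for every positive integer $n$ there is a chain in $A$ for $n$ of length at most $\lfloor\log_2 n\rfloor+\nu_2(n)-1$, and $\ell^A(2n)\le\ell^A(n)+1$. Put $\delta^A(n)=\ell^A(n)-\log_2 n$ and $\mathscr D^A=\{\delta^A(n): n\ge 1\}$. Call $m \ge 1$ \emph{$A$-stable} if $\ell^A(2^km)=k+\ell^A(m)$ for all $k\ge 0$, and let $\mathscr D^A_{st}=\{\delta^A(m): m\ge 1 \text{ is } A\text{-stable}\}$. \textbf{Theorem (well-ordering of initial segments of the $A$-defect set).} Let $A$ be an admissible set of addition chains and let $r\ge 0$ be a real number. The maximum \[ q=q^A(r)=\max\{\nu_2(n): n\ge 1,\ \delta^A(n)\le r\} \] exists, and $\mathscr D^A\cap[0,r]$ is a well-ordered subset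 of the real numbers with order type at least $\omega^{\lfloor r\rfloor}$ and at most \[ \omega^{q-1}q+\dots+\omega^2 3+\omega 2+1, \] which is less than $\omega^{q-1}(q+1)$, which in turn is less than $\omega^{q}$. The same is true of $\mathscr D^A_{st}\cap[0,r]$ (with the same $q=q^A(r)$). -/

import Mathlib

open scoped Ordinal

/-- An addition chain `(a_0, …, a_r)`: `a_0 = 1`, and every later term is a sum of two
(not necessarily distinct) earlier terms. The number `length` is `r`. -/
structure AddChain where
  /-- the length `r` of the chain `(a_0, …, a_r)` -/
  length : ℕ
  /-- the terms `a_0, …, a_r` -/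
  seq : Fin (length + 1) → ℕ
  seq_zero : seq 0 = 1
  seq_add : ∀ k, 0 < k → ∃ i < k, ∃ j < k, seq k = seq i + seq j

namespace AddChain

/-- The number for which the chain is an addition chain, i.e. its last term. -/
def target (c : AddChain) : ℕ := c.seq (Fin.last c.length)

/-- `ν₂(n)`: the number of `1`s in the binary expansion of `n`. -/
def binaryOnes (n : ℕ) : ℕ := (Nat.digits 2 n).count 1

/-- `ℓ^A(n)`: the smallest length of a chain in `A` for `n`. -/
noncomputable def minLength (A : Set AddChain) (n : ℕ) : ℕ :=
  sInf {r | ∃ c ∈ A, c.target = n ∧ c.length = r}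

/-- A set `A` of addition chains is admissible if for every positive integer `n` it contains
a chain for `n` of length at most `⌊log₂ n⌋ + ν₂(n) - 1`, and `ℓ^A(2n) ≤ ℓ^A(n) + 1`. -/
structure Admissible (A : Set AddChain) : Prop where
  exists_chain : ∀ n : ℕ, 0 < n →
    ∃ c ∈ A, c.target = n ∧ c.length ≤ Nat.log 2 n + binaryOnes n - 1
  minLength_two_mul_le : ∀ n : ℕ, 0 < n → minLength A (2 * n) ≤ minLength A n + 1

/-- The `A`-defect `δ^A(n) = ℓ^A(n) - log₂ n`. -/
noncomputable def defect (A : Set AddChain) (n : ℕ) : ℝ :=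
  (minLength A n : ℝ) - Real.logb 2 n

/-- `m` is `A`-stable if `ℓ^A(2^k m) = k + ℓ^A(m)` for every `k ≥ 0`. -/
def Stable (A : Set AddChain) (m : ℕ) : Prop :=
  ∀ k : ℕ, minLength A (2 ^ k * m) = k + minLength A m

/-- `𝒟^A`: the set of all `A`-defects of positive integers. -/
def defectSet (A : Set AddChain) : Set ℝ :=
  {x | ∃ n : ℕ, 0 < n ∧ defect A n = x}

/-- `𝒟^A_st`: the set of all `A`-defects of `A`-stable positive integers. -/
def stableDefectSet (A : Set AddChain) : Set ℝ :=
  {x | ∃ n : ℕ, 0 < n ∧ Stable A n ∧ defect A n = x}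

/-- The set of values `ν₂(n)`, over the positive integers `n` with `δ^A(n) ≤ r`. -/
def onesOfDefectLE (A : Set AddChain) (r : ℝ) : Set ℕ :=
  {m | ∃ n : ℕ, 0 < n ∧ defect A n ≤ r ∧ binaryOnes n = m}

/-- `q^A(r)`: the maximum of `ν₂(n)` over the positive integers `n` with `δ^A(n) ≤ r`. -/
noncomputable def maxOnes (A : Set AddChain) (r : ℝ) : ℕ :=
  sSup (onesOfDefectLE A r)

/-- The ordinal `ω^(q-1) · q + ⋯ + ω^2 · 3 + ω · 2 + 1` (highest powers of `ω` first). -/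
noncomputable def ordinalBound : ℕ → Ordinal.{0}
  | 0 => 0
  | q + 1 => ω ^ (q : Ordinal.{0}) * ((q + 1 : ℕ) : Ordinal.{0}) + ordinalBound q

end AddChain

namespace AddChain

/-! Write a number with `k + 1` binary ones as `2 ^ a` times a value in `[1, 2)` determined by its
`k` gaps between consecutive ones. A chain of length `s` reaches at most `2 ^ s`, and admissibility
gives length at most `a + k`, so the defect is `j - log₂ (gapValue k f)` with `0 ≤ j ≤ k`
(`exists_defect_eq`). For fixed `(k, j)` the defect increases with the gaps in lexicographic order,
that is, with an ordinal below `ω ^ k`.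

Upper bound: defects at most `r` only involve `k < q`, so they are covered by `k + 1` classes of
type at most `ω ^ k` for each such `k`. The type of a finite union is at most the natural sum of the
types, which here is `ordinalBound q`.

Lower bound: with `k = ⌊r⌋`, every gap sequence is realised by a stable number of defect at most
`k`. If the type were below `ω ^ k`, then `ω ^ k` would be covered by `k + 1` classes ranked below
that type, but a natural sum of finitely many ordinals below `ω ^ k` stays below `ω ^ k`.

That `q` is finite rests on `exists_ones_bound`: each non-doubling step at most doubles the maximal
number of ones but loses a fixed factor against `2 ^ s`. -/

theorem binaryOnes_two_mul (n : ℕ) : binaryOnes (2 * n) = binaryOnes n := by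
  rcases Nat.eq_zero_or_pos n with rfl | h
  · rfl
  · unfold binaryOnes
    rw [Nat.digits_def' one_lt_two (by omega)]
    simp

theorem binaryOnes_two_mul_add_one (n : ℕ) : binaryOnes (2 * n + 1) = binaryOnes n + 1 := by
  unfold binaryOnes
  rw [Nat.digits_def' one_lt_two (by omega)]
  have h1 : (2 * n + 1) % 2 = 1 := by omega
  have h2 : (2 * n + 1) / 2 = n := by omega
  simp [h1, h2]

theorem binaryOnes_zero : binaryOnes 0 = 0 := rfl

theorem binaryOnes_one : binaryOnes 1 = 1 := by
  simpa [binaryOnes_zero] using binaryOnes_two_mul_add_one 0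

theorem binaryOnes_pos {n : ℕ} (hn : 0 < n) : 0 < binaryOnes n := by
  induction n using Nat.strong_induction_on with
  | _ n ih =>
    obtain ⟨m, rfl | rfl⟩ := Nat.even_or_odd' n
    · rw [binaryOnes_two_mul]
      exact ih m (by omega) (by omega)
    · rw [binaryOnes_two_mul_add_one]
      omega

theorem binaryOnes_add_le (m n : ℕ) : binaryOnes (m + n) ≤ binaryOnes m + binaryOnes n := by
  induction hs : m + n using Nat.strong_induction_on generalizing m n with
  | _ s ih =>
    subst hs
    obtain ⟨a, rfl | rfl⟩ := Nat.even_or_odd' m <;> obtain ⟨b, rfl | rfl⟩ := Nat.even_or_odd' n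
    · rcases Nat.eq_zero_or_pos (a + b) with h | h
      · obtain ⟨rfl, rfl⟩ : a = 0 ∧ b = 0 := by omega
        simp [binaryOnes_zero]
      · rw [← mul_add, binaryOnes_two_mul, binaryOnes_two_mul, binaryOnes_two_mul]
        exact ih (a + b) (by omega) a b rfl
    · rw [← add_assoc, ← mul_add, binaryOnes_two_mul, binaryOnes_two_mul_add_one,
        binaryOnes_two_mul_add_one, ← add_assoc]
      exact Nat.succ_le_succ (ih (a + b) (by omega) a b rfl)
    · rw [show 2 * a + 1 + 2 * b = 2 * (a + b) + 1 by ring, binaryOnes_two_mul,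
        binaryOnes_two_mul_add_one, binaryOnes_two_mul_add_one]
      have := ih (a + b) (by omega) a b rfl
      omega
    · rw [show 2 * a + 1 + (2 * b + 1) = 2 * (a + b + 1) by ring, binaryOnes_two_mul,
        binaryOnes_two_mul_add_one, binaryOnes_two_mul_add_one]
      -- The carry of two odd numbers is absorbed by applying induction again to `(a + b) + 1`.
      have h1 := ih (a + b) (by omega) a b rfl
      have h2 := ih (a + b + 1) (by omega) (a + b) 1 rfl
      rw [binaryOnes_one] at h2
      omega

theorem binaryOnes_two_pow_mul (k n : ℕ) : binaryOnes (2 ^ k * n) = binaryOnes n := by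
  induction k with
  | zero => simp
  | succ k ih => rw [pow_succ', mul_assoc, binaryOnes_two_mul, ih]

theorem binaryOnes_two_pow_add {k n : ℕ} (hn : n < 2 ^ k) :
    binaryOnes (2 ^ k + n) = binaryOnes n + 1 := by
  induction k generalizing n with
  | zero =>
    obtain rfl : n = 0 := by simpa using hn
    simp [binaryOnes_zero, binaryOnes_one]
  | succ k ih =>
    rw [pow_succ'] at hn ⊢
    obtain ⟨m, rfl | rfl⟩ := Nat.even_or_odd' n
    · rw [← mul_add, binaryOnes_two_mul, binaryOnes_two_mul, ih (by omega)]
    · rw [← add_assoc, ← mul_add, binaryOnes_two_mul_add_one, binaryOnes_two_mul_add_one,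
        ih (by omega)]

/-! ### Chain length against the number of binary ones -/

/-- In an initial segment of an addition chain, let `P` bound all terms and let `Q` bound all
terms other than `P`. Steps that are not doublings increase `max P (4P/5 + 2Q/5)` at most by the
factor `9/5`, and only those steps can increase the number of binary ones. -/
theorem exists_prefix_bound (c : AddChain) (k : ℕ) (hk : k ≤ c.length) :
    ∃ P Q : ℝ, ∃ d : ℕ, 0 ≤ Q ∧ Q ≤ P ∧
      (∀ i : Fin (c.length + 1), i.1 ≤ k →
        ((c.seq i : ℝ) = P ∨ (c.seq i : ℝ) ≤ Q) ∧ binaryOnes (c.seq i) ≤ 2 ^ d) ∧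
      P ≤ 2 ^ k * (9 / 10) ^ d ∧ 4 / 5 * P + 2 / 5 * Q ≤ 2 ^ k * (9 / 10) ^ d := by
  induction k with
  | zero =>
    refine ⟨1, 0, 0, le_rfl, zero_le_one, fun i hi => ?_, by norm_num, by norm_num⟩
    obtain rfl : i = 0 := Fin.ext (by simpa using hi)
    simp [c.seq_zero, binaryOnes_one]
  | succ k ih =>
    obtain ⟨P, Q, d, hQ, hQP, hall, h1, h2⟩ := ih (by omega)
    obtain ⟨i, hi, j, hj, hij⟩ := c.seq_add ⟨k + 1, by omega⟩ (Fin.mk_lt_mk.2 (Nat.succ_pos k))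
    set x : Fin (c.length + 1) := ⟨k + 1, by omega⟩
    have hik : i.1 ≤ k := Nat.lt_succ_iff.1 hi
    have hjk : j.1 ≤ k := Nat.lt_succ_iff.1 hj
    obtain ⟨hi1, hi2⟩ := hall i hik
    obtain ⟨hj1, hj2⟩ := hall j hjk
    have hle : ∀ {y : ℝ}, y = P ∨ y ≤ Q → y ≤ P := fun h => h.elim le_of_eq fun h => h.trans hQP
    have hiP := hle hi1
    have hjP := hle hj1
    have hxR : (c.seq x : ℝ) = c.seq i + c.seq j := by rw [hij]; push_cast; rfl
    -- The new pair is `(P, P)` if the new term is at most `P`, and `(x, P)` otherwise; the bound on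
    -- `6 / 5 * P` is the weighted bound for `(P, P)`.
    have hcase : ∀ e : ℕ, d ≤ e → binaryOnes (c.seq x) ≤ 2 ^ e →
        P ≤ 2 ^ (k + 1) * (9 / 10) ^ e → 6 / 5 * P ≤ 2 ^ (k + 1) * (9 / 10) ^ e →
        (c.seq x : ℝ) ≤ 2 ^ (k + 1) * (9 / 10) ^ e →
        4 / 5 * (c.seq x : ℝ) + 2 / 5 * P ≤ 2 ^ (k + 1) * (9 / 10) ^ e →
        ∃ P Q : ℝ, ∃ d : ℕ, 0 ≤ Q ∧ Q ≤ P ∧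
      (∀ i : Fin (c.length + 1), i.1 ≤ k + 1 →
        ((c.seq i : ℝ) = P ∨ (c.seq i : ℝ) ≤ Q) ∧ binaryOnes (c.seq i) ≤ 2 ^ d) ∧
      P ≤ 2 ^ (k + 1) * (9 / 10) ^ d ∧
      4 / 5 * P + 2 / 5 * Q ≤ 2 ^ (k + 1) * (9 / 10) ^ d := by
      intro e hde hb hp1 hp2 hx1 hx2
      have hpow : 2 ^ d ≤ 2 ^ e := Nat.pow_le_pow_right two_pos hde
      rcases le_total (c.seq x : ℝ) P with hxP | hxP
      · refine ⟨P, P, e, hQ.trans hQP, le_rfl, fun l hl => ?_, hp1, by linarith⟩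
        rcases Nat.lt_or_eq_of_le hl with h | h
        · obtain ⟨ha, hb⟩ := hall l (by omega)
          exact ⟨Or.inr (hle ha), hb.trans hpow⟩
        · obtain rfl : l = x := Fin.ext h
          exact ⟨Or.inr hxP, hb⟩
      · refine ⟨c.seq x, P, e, hQ.trans hQP, hxP, fun l hl => ?_, hx1, hx2⟩
        rcases Nat.lt_or_eq_of_le hl with h | h
        · obtain ⟨ha, hb⟩ := hall l (by omega)
          exact ⟨Or.inr (hle ha), hb.trans hpow⟩
        · obtain rfl : l = x := Fin.ext h
          exact ⟨Or.inl rfl, hb⟩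
    set t : ℝ := 2 ^ k * (9 / 10) ^ d with ht
    by_cases heq : c.seq i = c.seq j
    -- The weights satisfy `4/5 * 2P + 2/5 * P = 2P`, so a doubling costs nothing.
    · have htd : (2 : ℝ) ^ (k + 1) * (9 / 10) ^ d = 2 * t := by rw [ht]; ring
      have hxx : (c.seq x : ℝ) = 2 * c.seq i := by rw [hxR, heq]; ring
      refine hcase d le_rfl ?_ ?_ ?_ ?_ ?_
      · rw [hij, ← heq, ← two_mul, binaryOnes_two_mul]
        exact hi2
      all_goals rw [htd]; linarith
    -- Unequal summands cannot both be `P`. The worst case of the linear constraints is `P = Q =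
    -- 5t/6`, giving `5t/3`, below `9t/5`.
    · have htd : (2 : ℝ) ^ (k + 1) * (9 / 10) ^ (d + 1) = 9 / 5 * t := by rw [ht]; ring
      have hxPQ : (c.seq x : ℝ) ≤ P + Q := by
        rcases hi1 with hi1 | hi1
        · rcases hj1 with hj1 | hj1
          · exact absurd (by exact_mod_cast hi1.trans hj1.symm) heq
          · linarith
        · linarith
      refine hcase (d + 1) (Nat.le_succ d) ?_ ?_ ?_ ?_ ?_
      · rw [hij, pow_succ]
        have := binaryOnes_add_le (c.seq i) (c.seq j)
        omega
      all_goals rw [htd]; linarith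

theorem exists_ones_bound (c : AddChain) : ∃ d : ℕ, binaryOnes c.target ≤ 2 ^ d ∧
    (c.target : ℝ) ≤ 2 ^ c.length * (9 / 10) ^ d := by
  obtain ⟨P, Q, d, -, hQP, hall, h, -⟩ := exists_prefix_bound c c.length le_rfl
  obtain ⟨h1, h2⟩ := hall (Fin.last _) le_rfl
  exact ⟨d, h2, (h1.elim le_of_eq fun h => h.trans hQP).trans h⟩

theorem target_le_two_pow (c : AddChain) : (c.target : ℝ) ≤ 2 ^ c.length := by
  obtain ⟨d, -, h⟩ := exists_ones_bound c
  exact h.trans (mul_le_of_le_one_right (by positivity)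
    (pow_le_one₀ (by norm_num) (by norm_num)))

/-! ### Defects, boundedness of the digit sum, stabilisation -/

variable {A : Set AddChain}

theorem Admissible.exists_minLength (hA : Admissible A) {n : ℕ} (hn : 0 < n) :
    ∃ c ∈ A, c.target = n ∧ c.length = minLength A n := by
  obtain ⟨c, hc, h, -⟩ := hA.exists_chain n hn
  exact Nat.sInf_mem (s := {r | ∃ c ∈ A, c.target = n ∧ c.length = r}) ⟨_, c, hc, h, rfl⟩

theorem Admissible.minLength_le (hA : Admissible A) {n : ℕ} (hn : 0 < n) :
    minLength A n ≤ Nat.log 2 n + binaryOnes n - 1 := by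
  obtain ⟨c, hc, h, hl⟩ := hA.exists_chain n hn
  exact le_trans (b := c.length) (by exact Nat.sInf_le ⟨c, hc, h, rfl⟩) hl

theorem Admissible.le_two_pow_minLength (hA : Admissible A) {n : ℕ} (hn : 0 < n) :
    (n : ℝ) ≤ 2 ^ minLength A n := by
  obtain ⟨c, -, rfl, hl⟩ := hA.exists_minLength hn
  rw [← hl]
  exact target_le_two_pow c

theorem Admissible.defect_nonneg (hA : Admissible A) {n : ℕ} (hn : 0 < n) : 0 ≤ defect A n := by
  have h : Real.logb 2 n ≤ minLength A n := by
    rw [Real.logb_le_iff_le_rpow one_lt_two (by exact_mod_cast hn), Real.rpow_natCast]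
    exact hA.le_two_pow_minLength hn
  exact sub_nonneg.2 h

theorem Admissible.defect_one (hA : Admissible A) : defect A 1 = 0 := by
  have h := hA.minLength_le one_pos
  simp only [binaryOnes_one, Nat.log_one_right, zero_add, Nat.sub_self, Nat.le_zero] at h
  simp [defect, h]

/-- Defect at most `r` means `2 ^ length ≤ 2 ^ r * n`, which forces `(10/9) ^ d ≤ 2 ^ r` and so
bounds `d`. -/
theorem Admissible.bddAbove_onesOfDefectLE (hA : Admissible A) (r : ℝ) :
    BddAbove (onesOfDefectLE A r) := by
  obtain ⟨D, hD⟩ := pow_unbounded_of_one_lt ((2 : ℝ) ^ r) (show (1 : ℝ) < 10 / 9 by norm_num)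
  refine ⟨2 ^ D, ?_⟩
  rintro m ⟨n, hn, hr, rfl⟩
  obtain ⟨c, -, rfl, hl⟩ := hA.exists_minLength hn
  obtain ⟨d, hd, hle⟩ := exists_ones_bound c
  have hn' : (0 : ℝ) < c.target := by exact_mod_cast hn
  refine hd.trans (Nat.pow_le_pow_right two_pos ?_)
  have h1 : (2 : ℝ) ^ c.length ≤ 2 ^ r * c.target := by
    have : (c.length : ℝ) ≤ r + Real.logb 2 c.target := by
      rw [defect, ← hl] at hr
      linarith
    calc (2 : ℝ) ^ c.length = 2 ^ (c.length : ℝ) := (Real.rpow_natCast _ _).symm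
      _ ≤ 2 ^ (r + Real.logb 2 c.target) := Real.rpow_le_rpow_of_exponent_le one_le_two this
      _ = 2 ^ r * c.target := by
        rw [Real.rpow_add two_pos, Real.rpow_logb two_pos (by norm_num) hn']
  have h2 : (10 / 9 : ℝ) ^ d ≤ 2 ^ r := by
    have h3 : (10 / 9 : ℝ) ^ d * (9 / 10) ^ d = 1 := by rw [← mul_pow]; norm_num
    have h4 : (c.target : ℝ) ≤ 2 ^ r * c.target * (9 / 10) ^ d :=
      hle.trans (mul_le_mul_of_nonneg_right h1 (by positivity))
    have h5 : (10 / 9 : ℝ) ^ d * c.target ≤ 2 ^ r * c.target := by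
      calc (10 / 9 : ℝ) ^ d * c.target
          ≤ (10 / 9 : ℝ) ^ d * (2 ^ r * c.target * (9 / 10) ^ d) := by gcongr
        _ = 2 ^ r * c.target * ((10 / 9 : ℝ) ^ d * (9 / 10) ^ d) := by ring
        _ = 2 ^ r * c.target := by rw [h3, mul_one]
    exact le_of_mul_le_mul_right h5 hn'
  exact ((pow_lt_pow_iff_right₀ (by norm_num)).1 (h2.trans_lt hD)).le

theorem Admissible.isGreatest_maxOnes (hA : Admissible A) {r : ℝ} (hr : 0 ≤ r) :
    IsGreatest (onesOfDefectLE A r) (maxOnes A r) := by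
  have hne : (onesOfDefectLE A r).Nonempty := ⟨_, 1, one_pos, by rwa [hA.defect_one], rfl⟩
  have hb := hA.bddAbove_onesOfDefectLE r
  exact ⟨Nat.sSup_mem hne hb, fun m hm => le_csSup hb hm⟩

theorem Admissible.maxOnes_pos (hA : Admissible A) {r : ℝ} (hr : 0 ≤ r) : 0 < maxOnes A r :=
  Nat.lt_of_lt_of_le (binaryOnes_pos one_pos)
    ((hA.isGreatest_maxOnes hr).2 ⟨1, one_pos, by rwa [hA.defect_one], rfl⟩)

/-- The quantity `minLength A (2 ^ k * n) - k` is a natural number that never increases with `k`;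
any `k` minimising it works. -/
theorem Admissible.exists_stable (hA : Admissible A) {n : ℕ} (hn : 0 < n) :
    ∃ k, Stable A (2 ^ k * n) := by
  have hpos : ∀ k, 0 < 2 ^ k * n := fun k => by positivity
  have hstep : ∀ m, 0 < m → ∀ k, minLength A (2 ^ k * m) ≤ k + minLength A m := by
    intro m hm k
    induction k with
    | zero => simp
    | succ k ih =>
      rw [pow_succ', mul_assoc]
      have := hA.minLength_two_mul_le (2 ^ k * m) (by positivity)
      omega
  have hlow : ∀ k, k ≤ minLength A (2 ^ k * n) := by
    intro k
    have h := hA.le_two_pow_minLength (hpos k)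
    have h' : 2 ^ k * n ≤ 2 ^ minLength A (2 ^ k * n) := by exact_mod_cast h
    exact (Nat.pow_le_pow_iff_right one_lt_two).1 ((Nat.le_mul_of_pos_right _ hn).trans h')
  obtain ⟨k, -, hk⟩ := WellFounded.has_min
    (InvImage.wf (fun k => minLength A (2 ^ k * n) - k) Nat.lt_wfRel.wf) Set.univ
    ⟨0, Set.mem_univ _⟩
  refine ⟨k, fun l => le_antisymm (hstep _ (hpos k) l) ?_⟩
  have h1 : ¬ (minLength A (2 ^ (l + k) * n) - (l + k) < minLength A (2 ^ k * n) - k) :=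
    hk (l + k) trivial
  have h2 := hlow (l + k)
  have h3 := hlow k
  rw [← mul_assoc, ← pow_add]
  omega

/-! ### Ordinals below `ω ^ n` as coefficient vectors, natural sums -/

/-- The ordinal `ω ^ (n - 1) * f (n - 1) + ⋯ + ω * f 1 + f 0`. Natural sums of such ordinals
correspond to pointwise sums of the coefficient functions. -/
noncomputable def omegaEval : ℕ → (ℕ → ℕ) → Ordinal.{0}
  | 0, _ => 0
  | n + 1, f => ω ^ (n : Ordinal.{0}) * (f n : Ordinal.{0}) + omegaEval n f

theorem opow_omega0_pos (n : ℕ) : 0 < ω ^ (n : Ordinal.{0}) :=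
  Ordinal.opow_pos _ Ordinal.omega0_pos

theorem opow_omega0_succ (n : ℕ) :
    ω ^ ((n + 1 : ℕ) : Ordinal.{0}) = ω ^ (n : Ordinal.{0}) * ω := by
  rw [Nat.cast_add, Nat.cast_one, ← Order.succ_eq_add_one, Ordinal.opow_succ]

theorem mul_natCast_add_lt {b x y : Ordinal.{0}} {c d : ℕ} (hx : x < b) (h : c < d) :
    b * (c : Ordinal.{0}) + x < b * (d : Ordinal.{0}) + y := by
  calc b * (c : Ordinal.{0}) + x < b * (c : Ordinal.{0}) + b := by gcongr
    _ = b * ((c + 1 : ℕ) : Ordinal.{0}) := by rw [Nat.cast_add, Nat.cast_one, mul_add, mul_one]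
    _ ≤ b * (d : Ordinal.{0}) := by gcongr; exact h
    _ ≤ _ := le_self_add

theorem omegaEval_lt (n : ℕ) (f : ℕ → ℕ) : omegaEval n f < ω ^ (n : Ordinal.{0}) := by
  induction n with
  | zero => simp [omegaEval]
  | succ n ih =>
    calc omegaEval (n + 1) f < ω ^ (n : Ordinal.{0}) * ((f n + 1 : ℕ) : Ordinal.{0}) + 0 :=
          mul_natCast_add_lt ih (Nat.lt_succ_self _)
      _ ≤ ω ^ ((n + 1 : ℕ) : Ordinal.{0}) := by
        rw [add_zero, opow_omega0_succ]
        gcongr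
        exact (Ordinal.natCast_lt_omega0 _).le

theorem omegaEval_succ_lt_iff {n : ℕ} {f g : ℕ → ℕ} : omegaEval (n + 1) f < omegaEval (n + 1) g ↔
    f n < g n ∨ f n = g n ∧ omegaEval n f < omegaEval n g := by
  rcases lt_trichotomy (f n) (g n) with h | h | h
  · simp only [h, true_or, iff_true]
    exact mul_natCast_add_lt (omegaEval_lt n f) h
  · simp [omegaEval, h]
  · simp only [h.not_gt, h.ne', false_and, or_self, iff_false, not_lt]
    exact (mul_natCast_add_lt (omegaEval_lt n g) h).le

/-- The order is lexicographic in the coefficients, hence cancellative, unlike ordinary ordinal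
addition on the right. -/
theorem omegaEval_add_lt {n : ℕ} {f g : ℕ → ℕ} (h : ℕ → ℕ) :
    omegaEval n (f + h) < omegaEval n (g + h) ↔ omegaEval n f < omegaEval n g := by
  induction n with
  | zero => simp [omegaEval]
  | succ n ih => simp [omegaEval_succ_lt_iff, ih]

theorem omegaEval_add_le {n : ℕ} {f g : ℕ → ℕ} (h : ℕ → ℕ) :
    omegaEval n (f + h) ≤ omegaEval n (g + h) ↔ omegaEval n f ≤ omegaEval n g := by
  rw [← not_lt, ← not_lt, omegaEval_add_lt]

theorem omegaEval_sum_le {ι : Type*} (s : Finset ι) {n : ℕ} {f g : ι → ℕ → ℕ}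
    (h : ∀ i ∈ s, omegaEval n (f i) ≤ omegaEval n (g i)) :
    omegaEval n (∑ i ∈ s, f i) ≤ omegaEval n (∑ i ∈ s, g i) := by
  classical
  induction s using Finset.induction_on with
  | empty => rfl
  | insert a s ha ih =>
    rw [Finset.sum_insert ha, Finset.sum_insert ha]
    calc omegaEval n (f a + ∑ i ∈ s, f i) ≤ omegaEval n (g a + ∑ i ∈ s, f i) :=
          (omegaEval_add_le _).2 (h a (Finset.mem_insert_self a s))
      _ ≤ omegaEval n (g a + ∑ i ∈ s, g i) := by
        rw [add_comm (g a), add_comm (g a), omegaEval_add_le]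
        exact ih fun i hi => h i (Finset.mem_insert_of_mem hi)

theorem omegaEval_sum_lt {ι : Type*} {s : Finset ι} {n : ℕ} {f g : ι → ℕ → ℕ}
    (h : ∀ i ∈ s, omegaEval n (f i) ≤ omegaEval n (g i)) {a : ι} (ha : a ∈ s)
    (hlt : omegaEval n (f a) < omegaEval n (g a)) :
    omegaEval n (∑ i ∈ s, f i) < omegaEval n (∑ i ∈ s, g i) := by
  classical
  rw [← Finset.add_sum_erase s f ha, ← Finset.add_sum_erase s g ha]
  calc omegaEval n (f a + ∑ i ∈ s.erase a, f i) < omegaEval n (g a + ∑ i ∈ s.erase a, f i) :=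
        (omegaEval_add_lt _).2 hlt
    _ ≤ omegaEval n (g a + ∑ i ∈ s.erase a, g i) := by
      rw [add_comm (g a), add_comm (g a), omegaEval_add_le]
      exact omegaEval_sum_le _ fun i hi => h i (Finset.mem_of_mem_erase hi)

theorem omegaEval_congr {n : ℕ} {f g : ℕ → ℕ} (h : ∀ i < n, f i = g i) :
    omegaEval n f = omegaEval n g := by
  induction n with
  | zero => rfl
  | succ n ih =>
    rw [omegaEval, omegaEval, h n (Nat.lt_succ_self n), ih fun i hi => h i (hi.trans n.lt_succ_self)]

theorem omegaEval_zero (n : ℕ) : omegaEval n 0 = 0 := by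
  induction n with
  | zero => rfl
  | succ n ih => simp [omegaEval, ih]

theorem omegaEval_single {n k : ℕ} (h : k < n) :
    omegaEval n (Pi.single k 1) = ω ^ (k : Ordinal.{0}) := by
  induction n with
  | zero => omega
  | succ n ih =>
    rcases Nat.lt_succ_iff_lt_or_eq.1 h with h' | rfl
    · simp [omegaEval, ih h', h'.ne']
    · have : omegaEval k (Pi.single k 1) = omegaEval k 0 :=
        omegaEval_congr fun i hi => by simp [hi.ne]
      simp [omegaEval, this, omegaEval_zero]

theorem exists_omegaEval_eq {n : ℕ} {o : Ordinal.{0}} (ho : o < ω ^ (n : Ordinal.{0})) :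
    ∃ f, omegaEval n f = o := by
  induction n generalizing o with
  | zero => exact ⟨0, by simpa [omegaEval, eq_comm] using ho⟩
  | succ n ih =>
    have h0 := (opow_omega0_pos n).ne'
    rw [opow_omega0_succ] at ho
    obtain ⟨d, hd⟩ := Ordinal.lt_omega0.1 ((Ordinal.lt_mul_iff_div_lt h0).1 ho)
    obtain ⟨f, hf⟩ := ih (Ordinal.mod_lt o h0)
    refine ⟨Function.update f n d, ?_⟩
    have : omegaEval n (Function.update f n d) = omegaEval n f :=
      omegaEval_congr fun i hi => by simp [hi.ne]
    rw [omegaEval, Function.update_self, this, hf, ← hd, Ordinal.div_add_mod]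

theorem ordinalBound_eq_omegaEval (q : ℕ) : ordinalBound q = omegaEval q (fun i => i + 1) := by
  induction q with
  | zero => rfl
  | succ q ih => rw [ordinalBound, omegaEval, ih]

theorem ordinalBound_lt {q : ℕ} (hq : 0 < q) :
    ordinalBound q < ω ^ ((q - 1 : ℕ) : Ordinal.{0}) * ((q + 1 : ℕ) : Ordinal.{0}) := by
  obtain ⟨q, rfl⟩ := Nat.exists_eq_succ_of_ne_zero hq.ne'
  rw [ordinalBound, Nat.succ_sub_one, ordinalBound_eq_omegaEval]
  simpa using mul_natCast_add_lt (y := 0) (omegaEval_lt q _) (Nat.lt_succ_self (q + 1))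

theorem opow_omega0_mul_natCast_lt {q : ℕ} (hq : 0 < q) (n : ℕ) :
    ω ^ ((q - 1 : ℕ) : Ordinal.{0}) * (n : Ordinal.{0}) < ω ^ (q : Ordinal.{0}) := by
  obtain ⟨q, rfl⟩ := Nat.exists_eq_succ_of_ne_zero hq.ne'
  rw [Nat.succ_sub_one, Nat.succ_eq_add_one, opow_omega0_succ]
  exact mul_lt_mul_of_pos_left (Ordinal.natCast_lt_omega0 n) (opow_omega0_pos q)

/-- If a linear order is covered by finitely many classes on which ordinal ranks bounded by
`omegaEval n (a i)` are strictly increasing, then it has a strictly increasing ordinal rank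
bounded by the natural sum of these bounds. -/
theorem exists_strictMono_lt_omegaEval_sum {X ι : Type*} [LinearOrder X] [Fintype ι] {n : ℕ}
    (c : X → ι) (g : X → Ordinal.{0}) (hg : ∀ x y, x < y → c x = c y → g x < g y)
    (a : ι → ℕ → ℕ) (ha : ∀ x, g x < omegaEval n (a (c x))) :
    ∃ F : X → Ordinal.{0}, StrictMono F ∧ ∀ x, F x < omegaEval n (∑ i, a i) := by
  -- `sInf (R i x)` is the least rank in class `i` at or above `x`, with the class bound as default.
  -- It is monotone in `x`, and strictly increases on leaving `x` upwards when `i = c x`, so the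
  -- natural sum over `i` is strictly monotone.
  let R : ι → X → Set Ordinal.{0} := fun i x =>
    insert (omegaEval n (a i)) {o | ∃ y, x ≤ y ∧ c y = i ∧ g y = o}
  have hR : ∀ i x, sInf (R i x) ≤ omegaEval n (a i) := fun i x => csInf_le' (Set.mem_insert _ _)
  have hmem : ∀ x, sInf (R (c x) x) ≤ g x :=
    fun x => csInf_le' (Set.mem_insert_of_mem _ ⟨x, le_rfl, rfl, rfl⟩)
  have hmono : ∀ i x y, x ≤ y → sInf (R i x) ≤ sInf (R i y) := fun i x y hxy =>
    csInf_le_csInf' (Set.insert_nonempty _ _)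
      (Set.insert_subset_insert fun o ⟨z, hz, h⟩ => ⟨z, hxy.trans hz, h⟩)
  have hlt : ∀ x y, x < y → g x < sInf (R (c x) y) := by
    intro x y hxy
    obtain h | ⟨z, hz, hc, h⟩ := csInf_mem (s := R (c x) y) (Set.insert_nonempty _ _)
    · rw [h]; exact ha x
    · rw [← h]; exact hg x z (hxy.trans_le hz) hc.symm
  choose f hf using fun i x =>
    exists_omegaEval_eq ((hR i x).trans_lt (omegaEval_lt n (a i)))
  refine ⟨fun x => omegaEval n (∑ i, f i x), fun x y hxy => ?_, fun x => ?_⟩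
  · refine omegaEval_sum_lt (fun i _ => ?_) (Finset.mem_univ (c x)) ?_
    · rw [hf, hf]; exact hmono i x y hxy.le
    · rw [hf, hf]; exact (hmem x).trans_lt (hlt x y hxy)
  · refine omegaEval_sum_lt (fun i _ => ?_) (Finset.mem_univ (c x)) ?_
    · rw [hf]; exact hR i x
    · rw [hf]; exact (hmem x).trans_lt (ha x)

/-- A strictly increasing ordinal rank dominates the position in the well-order, so no element can
sit at position `b`. -/
theorem type_le_of_strictMono {X : Type} [LinearOrder X] [WellFoundedLT X] {F : X → Ordinal.{0}}
    (hF : StrictMono F) {b : Ordinal.{0}} (hb : ∀ x, F x < b) :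
    Ordinal.type (fun x y : X => x < y) ≤ b := by
  by_contra! h
  obtain ⟨x, hx⟩ := Ordinal.typein_surj (fun x y : X => x < y) h
  have key : ∀ y : X, Ordinal.typein (fun x y : X => x < y) y ≤ F y := by
    intro y
    induction y using WellFoundedLT.induction with
    | _ y ih =>
      by_contra! hlt
      obtain ⟨z, hz⟩ := Ordinal.typein_surj (fun x y : X => x < y)
        (hlt.trans (Ordinal.typein_lt_type _ y))
      rw [← hz, Ordinal.typein_lt_typein] at hlt
      exact ((ih z hlt).trans_lt (hF hlt)).ne hz
  exact ((key x).trans_lt (hb x)).ne hx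

/-! ### Binary expansions as gap sequences -/

/-- The real number `2 ^ 0 + 2 ^ (-e_1) + ⋯ + 2 ^ (-e_k)` whose exponents have the gaps
`f (k - 1) + 1, …, f 0 + 1`. -/
noncomputable def gapValue : ℕ → (ℕ → ℕ) → ℝ
  | 0, _ => 1
  | k + 1, f => 1 + gapValue k f / 2 ^ (f k + 1)

theorem one_le_gapValue (k : ℕ) (f : ℕ → ℕ) : 1 ≤ gapValue k f := by
  induction k with
  | zero => exact le_rfl
  | succ k ih =>
    have : 0 ≤ gapValue k f / 2 ^ (f k + 1) := by positivity
    rw [gapValue]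
    linarith

theorem gapValue_lt_two (k : ℕ) (f : ℕ → ℕ) : gapValue k f < 2 := by
  induction k with
  | zero => exact one_lt_two
  | succ k ih =>
    have : gapValue k f / 2 ^ (f k + 1) < 1 := by
      rw [div_lt_one (by positivity)]
      exact ih.trans_le (le_self_pow₀ one_le_two (Nat.succ_ne_zero _))
    rw [gapValue]
    linarith

theorem gapValue_congr {k : ℕ} {f g : ℕ → ℕ} (h : ∀ i < k, f i = g i) :
    gapValue k f = gapValue k g := by
  induction k with
  | zero => rfl
  | succ n ih =>
    rw [gapValue, gapValue, h n (Nat.lt_succ_self n), ih fun i hi => h i (hi.trans n.lt_succ_self)]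

/-- A larger leading gap at least doubles the denominator, which outweighs all later gaps because
values lie in `[1, 2)`. -/
theorem gapValue_lt_of_omegaEval_lt {k : ℕ} {f g : ℕ → ℕ} (h : omegaEval k f < omegaEval k g) :
    gapValue k g < gapValue k f := by
  induction k with
  | zero => simp [omegaEval] at h
  | succ k ih =>
    rw [gapValue, gapValue, add_lt_add_iff_left]
    rcases omegaEval_succ_lt_iff.1 h with h | ⟨h, h'⟩
    · calc gapValue k g / 2 ^ (g k + 1) ≤ gapValue k g / 2 ^ (f k + 1 + 1) := by
            have := one_le_gapValue k g
            gcongr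
            · exact one_le_two
            · omega
        _ < 2 / 2 ^ (f k + 1 + 1) := by gcongr; exact gapValue_lt_two k g
        _ = 1 / 2 ^ (f k + 1) := by rw [pow_succ _ (f k + 1)]; field_simp
        _ ≤ gapValue k f / 2 ^ (f k + 1) := by gcongr; exact one_le_gapValue k f
    · rw [h]
      gcongr
      exact ih h'

theorem omegaEval_inj {k : ℕ} {f g : ℕ → ℕ} (h : omegaEval k f = omegaEval k g) :
    ∀ i < k, f i = g i := by
  induction k with
  | zero => simp
  | succ k ih =>
    have h1 := (omegaEval_succ_lt_iff (n := k) (f := f) (g := g)).not.1 h.not_lt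
    have h2 := (omegaEval_succ_lt_iff (n := k) (f := g) (g := f)).not.1 h.not_gt
    push Not at h1 h2
    have h3 : f k = g k := le_antisymm h2.1 h1.1
    intro i hi
    rcases Nat.lt_succ_iff_lt_or_eq.1 hi with hi | rfl
    · exact ih (le_antisymm (h2.2 h3.symm) (h1.2 h3)) i hi
    · exact h3

theorem omegaEval_lt_of_gapValue_lt {k : ℕ} {f g : ℕ → ℕ} (h : gapValue k g < gapValue k f) :
    omegaEval k f < omegaEval k g := by
  rcases lt_trichotomy (omegaEval k f) (omegaEval k g) with h' | h' | h'
  · exact h'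
  · exact absurd (gapValue_congr (omegaEval_inj h')) h.ne'
  · exact absurd h (gapValue_lt_of_omegaEval_lt h').not_gt

theorem exists_eq_two_pow_mul_gapValue {k n : ℕ} (hn : binaryOnes n = k + 1) :
    ∃ f : ℕ → ℕ, (n : ℝ) = 2 ^ Nat.log 2 n * gapValue k f := by
  induction k generalizing n with
  | zero =>
    have hn0 : n ≠ 0 := by rintro rfl; simp [binaryOnes_zero] at hn
    obtain ⟨m, hm⟩ := Nat.exists_eq_add_of_le (Nat.pow_log_le_self 2 hn0)
    have hlt : m < 2 ^ Nat.log 2 n := by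
      have := Nat.lt_pow_succ_log_self one_lt_two n
      rw [Nat.pow_succ] at this
      omega
    have h1 : binaryOnes m + 1 = 1 := by
      rw [← binaryOnes_two_pow_add hlt, ← hm, hn]
    have h2 : m = 0 := by
      by_contra h
      have := binaryOnes_pos (Nat.pos_of_ne_zero h)
      omega
    refine ⟨0, ?_⟩
    rw [gapValue, mul_one]
    rw [h2, add_zero] at hm
    exact_mod_cast hm
  | succ k ih =>
    have hn0 : n ≠ 0 := by rintro rfl; simp [binaryOnes_zero] at hn
    obtain ⟨m, hm⟩ := Nat.exists_eq_add_of_le (Nat.pow_log_le_self 2 hn0)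
    have hlt : m < 2 ^ Nat.log 2 n := by
      have := Nat.lt_pow_succ_log_self one_lt_two n
      rw [Nat.pow_succ] at this
      omega
    have h1 : binaryOnes m + 1 = k + 1 + 1 := by
      rw [← binaryOnes_two_pow_add hlt, ← hm, hn]
    obtain ⟨f, hf⟩ := ih (Nat.succ_injective h1)
    have hm0 : m ≠ 0 := by rintro rfl; simp [binaryOnes_zero] at h1
    have hlog : Nat.log 2 m < Nat.log 2 n := Nat.log_lt_of_lt_pow hm0 hlt
    obtain ⟨d, hd⟩ := Nat.exists_eq_add_of_lt hlog
    -- Here `d + 1` is the distance from the leading one to the next.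
    refine ⟨Function.update f k d, ?_⟩
    have hc : gapValue k (Function.update f k d) = gapValue k f :=
      gapValue_congr fun i hi => by simp [hi.ne]
    have hmR : (n : ℝ) = 2 ^ Nat.log 2 n + m := by exact_mod_cast hm
    rw [gapValue, hc, Function.update_self, hmR, hf, hd]
    field_simp
    ring

theorem exists_binaryOnes_eq_gapValue (k : ℕ) (f : ℕ → ℕ) : ∃ n a : ℕ,
    binaryOnes n = k + 1 ∧ (n : ℝ) = 2 ^ a * gapValue k f := by
  induction k with
  | zero => exact ⟨1, 0, binaryOnes_one, by simp [gapValue]⟩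
  | succ k ih =>
    obtain ⟨m, a, hm, hv⟩ := ih
    have hlt : m < 2 ^ (a + f k + 1) := by
      have : (m : ℝ) < 2 ^ (a + f k + 1) := by
        calc (m : ℝ) = 2 ^ a * gapValue k f := hv
          _ < 2 ^ a * 2 := by gcongr; exact gapValue_lt_two k f
          _ = 2 ^ (a + 1) := (pow_succ _ _).symm
          _ ≤ 2 ^ (a + f k + 1) := pow_le_pow_right₀ one_le_two (by omega)
      exact_mod_cast this
    refine ⟨2 ^ (a + f k + 1) + m, a + f k + 1, ?_, ?_⟩
    · rw [binaryOnes_two_pow_add hlt, hm]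
    · push_cast
      rw [hv, gapValue]
      field_simp
      ring

/-! ### Order types of the defect sets -/

variable {A : Set AddChain}

theorem Admissible.exists_defect_eq (hA : Admissible A) {n k a : ℕ} {f : ℕ → ℕ}
    (hn : binaryOnes n = k + 1) (hv : (n : ℝ) = 2 ^ a * gapValue k f) :
    ∃ j : Fin (k + 1), defect A n = (j : ℕ) - Real.logb 2 (gapValue k f) := by
  have hn0 : 0 < n := by
    rcases Nat.eq_zero_or_pos n with rfl | h
    · simp [binaryOnes_zero] at hn
    · exact h
  have h1 := one_le_gapValue k f
  have h2 := gapValue_lt_two k f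
  have hle : 2 ^ a ≤ n := by
    have : (2 : ℝ) ^ a ≤ n := by rw [hv]; exact le_mul_of_one_le_right (by positivity) h1
    exact_mod_cast this
  have hlt : n < 2 ^ (a + 1) := by
    have : (n : ℝ) < 2 ^ (a + 1) := by rw [hv, pow_succ]; gcongr
    exact_mod_cast this
  have hlog : Nat.log 2 n = a := (Nat.log_eq_iff (Or.inr ⟨one_lt_two, hn0.ne'⟩)).2 ⟨hle, hlt⟩
  have hup := hA.minLength_le hn0
  rw [hlog, hn] at hup
  have hlow : a ≤ minLength A n := by
    have h3 : n ≤ 2 ^ minLength A n := by exact_mod_cast hA.le_two_pow_minLength hn0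
    exact (Nat.pow_le_pow_iff_right one_lt_two).1 (hle.trans h3)
  refine ⟨⟨minLength A n - a, by omega⟩, ?_⟩
  rw [defect, hv, Real.logb_mul (by positivity) (by positivity), Real.logb_pow,
    Real.logb_self_eq_one one_lt_two, Nat.cast_sub hlow]
  ring

theorem Admissible.exists_rank (hA : Admissible A) (r : ℝ) (hr : 0 ≤ r) :
    ∃ F : ↥(defectSet A ∩ Set.Icc 0 r) → Ordinal.{0}, StrictMono F ∧
      ∀ x, F x < ordinalBound (maxOnes A r) := by
  set q := maxOnes A r
  have key : ∀ x : ↥(defectSet A ∩ Set.Icc 0 r), ∃ p : (Σ k : Fin q, Fin (k + 1)), ∃ f : ℕ → ℕ,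
      (x : ℝ) = (p.2 : ℕ) - Real.logb 2 (gapValue p.1 f) := by
    rintro ⟨x, ⟨n, hn, hx⟩, hx0, hxr⟩
    have hle : binaryOnes n ≤ q := (hA.isGreatest_maxOnes hr).2 ⟨n, hn, hx.trans_le hxr, rfl⟩
    obtain ⟨k, hk⟩ := Nat.exists_eq_succ_of_ne_zero (binaryOnes_pos hn).ne'
    obtain ⟨f, hf⟩ := exists_eq_two_pow_mul_gapValue hk
    obtain ⟨j, hj⟩ := hA.exists_defect_eq hk hf
    exact ⟨⟨⟨k, by omega⟩, j⟩, f, hx.symm.trans hj⟩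
  choose c f hf using key
  have hmono : ∀ x y, x < y → c x = c y →
      omegaEval (c x).1 (f x) < omegaEval (c y).1 (f y) := by
    intro x y hxy hc
    have hxy' : (x : ℝ) < y := hxy
    have hj : ((c x).2 : ℕ) = (c y).2 := by rw [hc]
    have hx := hf x
    have hy := hf y
    rw [hj] at hx
    simp only [hc] at hx ⊢
    apply omegaEval_lt_of_gapValue_lt
    have h1 := one_le_gapValue (c y).1 (f x)
    have h2 := one_le_gapValue (c y).1 (f y)
    rw [← Real.logb_lt_logb_iff one_lt_two (by positivity) (by positivity)]
    linarith
  -- Class `(k, j)` has bound `ω ^ k`; the `k + 1` choices of `j` produce the coefficient `k + 1`.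
  obtain ⟨F, hF, hb⟩ := exists_strictMono_lt_omegaEval_sum (n := q) c
    (fun x => omegaEval (c x).1 (f x)) hmono (fun p => Pi.single (p.1 : ℕ) 1)
    fun x => (omegaEval_lt _ _).trans_eq (omegaEval_single (c x).1.2).symm
  refine ⟨F, hF, fun x => (hb x).trans_eq ?_⟩
  rw [ordinalBound_eq_omegaEval]
  refine omegaEval_congr fun i hi => ?_
  rw [Fintype.sum_sigma, Finset.sum_apply, Finset.sum_eq_single ⟨i, hi⟩]
  · simp
  · intro b _ hbi
    have : i ≠ b := fun h => hbi (Fin.ext h.symm)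
    simp [this]
  · simp

theorem Admissible.opow_le_type (hA : Admissible A) (r : ℝ) (hr : 0 ≤ r) (S : Set ℝ)
    (hS : stableDefectSet A ∩ Set.Icc 0 r ⊆ S) [WellFoundedLT S] :
    ω ^ ((⌊r⌋₊ : ℕ) : Ordinal.{0}) ≤ Ordinal.type (fun x y : S => x < y) := by
  set k := ⌊r⌋₊
  by_contra! hlt
  obtain ⟨t, ht⟩ := exists_omegaEval_eq hlt
  have key : ∀ o : Set.Iio (ω ^ (k : Ordinal.{0})), ∃ f, omegaEval k f = o ∧
      ∃ j : Fin (k + 1), ∃ s : S, (s : ℝ) = (j : ℕ) - Real.logb 2 (gapValue k f) := by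
    rintro ⟨o, ho⟩
    obtain ⟨f, rfl⟩ := exists_omegaEval_eq ho
    obtain ⟨n, a, hn, hv⟩ := exists_binaryOnes_eq_gapValue k f
    have hn0 : 0 < n := by
      rcases Nat.eq_zero_or_pos n with rfl | h
      · simp [binaryOnes_zero] at hn
      · exact h
    obtain ⟨l, hl⟩ := hA.exists_stable hn0
    have hpos : 0 < 2 ^ l * n := by positivity
    obtain ⟨j, hj⟩ := hA.exists_defect_eq (n := 2 ^ l * n) (k := k) (a := l + a) (f := f)
      ((binaryOnes_two_pow_mul l n).trans hn) (by push_cast; rw [hv]; ring)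
    refine ⟨f, rfl, j, ⟨_, hS ⟨⟨_, hpos, hl, rfl⟩, hA.defect_nonneg hpos, ?_⟩⟩, hj⟩
    have h1 : 0 ≤ Real.logb 2 (gapValue k f) := Real.logb_nonneg one_lt_two (one_le_gapValue k f)
    have h2 : ((j : ℕ) : ℝ) ≤ k := by exact_mod_cast Nat.lt_succ_iff.1 j.2
    have h3 : (k : ℝ) ≤ r := Nat.floor_le hr
    linarith
  choose f hf c s hs using key
  have hmono : ∀ x y, x < y → c x = c y → Ordinal.typein (fun x y : S => x < y) (s x) <
      Ordinal.typein (fun x y : S => x < y) (s y) := by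
    intro x y hxy hc
    rw [Ordinal.typein_lt_typein]
    change (s x : ℝ) < s y
    have h1 : omegaEval k (f x) < omegaEval k (f y) := by rw [hf, hf]; exact hxy
    have h2 := gapValue_lt_of_omegaEval_lt h1
    have h3 := one_le_gapValue k (f y)
    rw [hs, hs, hc]
    have := Real.logb_lt_logb one_lt_two (zero_lt_one.trans_le h3) h2
    linarith
  obtain ⟨F, hF, hb⟩ := exists_strictMono_lt_omegaEval_sum (n := k) c
    (fun x => Ordinal.typein (fun x y : S => x < y) (s x)) hmono (fun _ => t)
    fun x => (Ordinal.typein_lt_type _ _).trans_eq ht.symm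
  -- A strictly increasing map on an initial segment of ordinals never goes below the identity.
  have hself : ∀ o : Set.Iio (ω ^ (k : Ordinal.{0})), (o : Ordinal.{0}) ≤ F o := by
    intro o
    induction o using WellFoundedLT.induction with
    | _ o ih =>
      by_contra! h
      have h' := ih ⟨F o, h.trans o.2⟩ h
      exact (h'.trans_lt (hF (show (⟨F o, h.trans o.2⟩ : Set.Iio _) < o from h))).false
  -- The natural sum of `k + 1` copies of `t` is itself below `ω ^ k`, yet bounds every value of `F`
  -- strictly.
  let o : Set.Iio (ω ^ (k : Ordinal.{0})) := ⟨omegaEval k (∑ _i : Fin (k + 1), t), omegaEval_lt _ _⟩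
  exact ((hself o).trans_lt (hb o)).false

theorem stableDefectSet_subset : stableDefectSet A ⊆ defectSet A :=
  fun _ ⟨n, hn, _, h⟩ => ⟨n, hn, h⟩

theorem Admissible.order_type_bounds (hA : Admissible A) {r : ℝ} (hr : 0 ≤ r) {S : Set ℝ}
    (hS : stableDefectSet A ∩ Set.Icc 0 r ⊆ S) (hS' : S ⊆ defectSet A ∩ Set.Icc 0 r) :
    ∃ _ : WellFoundedLT S, ω ^ ((⌊r⌋₊ : ℕ) : Ordinal.{0}) ≤ Ordinal.type (fun x y : S => x < y) ∧
      Ordinal.type (fun x y : S => x < y) ≤ ordinalBound (maxOnes A r) := by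
  obtain ⟨F, hF, hb⟩ := hA.exists_rank r hr
  have hG : StrictMono fun x : S => F ⟨x, hS' x.2⟩ := fun x y h => hF h
  have hwf : WellFoundedLT S := hG.wellFoundedLT
  exact ⟨hwf, hA.opow_le_type r hr S hS, type_le_of_strictMono hG fun x => hb _⟩

end AddChain

theorem mainTheorem3 (A : Set AddChain) (hA : AddChain.Admissible A) (r : ℝ) (hr : 0 ≤ r) :
    IsGreatest (AddChain.onesOfDefectLE A r) (AddChain.maxOnes A r) ∧
    (∃ _ : WellFoundedLT ↥(AddChain.defectSet A ∩ Set.Icc 0 r),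
      ω ^ ((⌊r⌋₊ : ℕ) : Ordinal.{0}) ≤
        Ordinal.type (fun x y : ↥(AddChain.defectSet A ∩ Set.Icc 0 r) => x < y) ∧
      Ordinal.type (fun x y : ↥(AddChain.defectSet A ∩ Set.Icc 0 r) => x < y) ≤
        AddChain.ordinalBound (AddChain.maxOnes A r)) ∧
    (∃ _ : WellFoundedLT ↥(AddChain.stableDefectSet A ∩ Set.Icc 0 r),
      ω ^ ((⌊r⌋₊ : ℕ) : Ordinal.{0}) ≤
        Ordinal.type (fun x y : ↥(AddChain.stableDefectSet A ∩ Set.Icc 0 r) => x < y) ∧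
      Ordinal.type (fun x y : ↥(AddChain.stableDefectSet A ∩ Set.Icc 0 r) => x < y) ≤
        AddChain.ordinalBound (AddChain.maxOnes A r)) ∧
    AddChain.ordinalBound (AddChain.maxOnes A r) <
      ω ^ ((AddChain.maxOnes A r - 1 : ℕ) : Ordinal.{0}) *
        ((AddChain.maxOnes A r + 1 : ℕ) : Ordinal.{0}) ∧
    ω ^ ((AddChain.maxOnes A r - 1 : ℕ) : Ordinal.{0}) *
        ((AddChain.maxOnes A r + 1 : ℕ) : Ordinal.{0}) <
      ω ^ ((AddChain.maxOnes A r : ℕ) : Ordinal.{0}) := by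
  have hq := hA.maxOnes_pos hr
  exact ⟨hA.isGreatest_maxOnes hr,
    hA.order_type_bounds hr (Set.inter_subset_inter_left _ AddChain.stableDefectSet_subset) le_rfl,
    hA.order_type_bounds hr le_rfl (Set.inter_subset_inter_left _ AddChain.stableDefectSet_subset),
    AddChain.ordinalBound_lt hq, AddChain.opow_omega0_mul_natCast_lt hq _⟩
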